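/- For $\tau$ in the upper half-plane put $q=e^{2\pi i\tau}$ (so $0<|q|<1$) and $q^{r}=e^{2\pi i r\tau}$ for real $r$. Let $$a(q)=-\sum_{n=-\infty}^{\infty}(-1)^n q^{(14n+5)^2/56},\quad b(q)=\sum_{n=-\infty}^{\infty}(-1)^n q^{(14n+3)^2/56},\quad c(q)=\sum_{n=-\infty}^{\infty}(-1)^n q^{(14n+1)^2/56},$$ let $(\alpha;q)_\infty=\prod_{k=0}^{\infty}(1-\alpha q^k)$, and define the septic parameters $$x=q^{7/8}(q^7;q^7)_\infty^3\,\frac{b(q)}{c(q)^2},\qquad y=-q^{7/8}(q^7;q^7)_\infty^3\,\frac{a(q)}{b(q)^2},\qquad z=q^{7/8}(q^7;q^7)_\infty^3\,\frac{c(q)}{a(q)^2}.$$ For $k\ge 1$ let $$E_{2k}(q)=1+\frac{2}{\zeta(1-2k)}\sum_{n=1}^{\infty}\frac{n^{2k-1}q^n}{1-q^n},$$ where $\zeta$ is the analytically continued Riemann zeta function. Then, for every such $\tau$, \begin{align*} E_4(q)={}&x^4-116x^3y+116xy^3+y^4-116x^3z+848xyz^2+848x^2yz-848xy^2z\\&-116y^3z+116xz^3+116yz^3+z^4,\\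 E_4(q^7)={}&x^4+4x^3y-4xy^3+y^4+4x^3z+8xyz^2+8x^2yz-8xy^2z\\&+4y^3z-4xz^3-4yz^3+z^4,\\ E_6(q)={}&x^6+258x^5y-5904x^4y^2-5904x^2y^4-258xy^5+y^6+258x^5z+7310x^3y^2z\\&+7310x^2y^3z+258y^5z-5904x^4z^2+7310x^3yz^2-8751x^2y^2z^2-7310xy^3z^2\\&-5904y^4z^2-7310x^2yz^3-7310xy^2z^3-5904x^2z^4-5904y^2z^4-258xz^5\\&-258yz^5+z^6,\\ E_6(q^7)={}&x^6+6x^5y+18x^4y^2+18x^2y^4-6xy^5+y^6+6x^5z+2x^3y^2z\\&+2x^2y^3z+6y^5z+18x^4z^2+2x^3yz^2-57x^2y^2z^2-2xy^3z^2\\&+18y^4z^2-2x^2yz^3-2xy^2z^3+18x^2z^4+18y^2z^4-6xz^5\\&-6yz^5+z^6. \end{align*} -/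

import Mathlib

open scoped UpperHalfPlane

noncomputable section

namespace Septic

/-- The real power `q ^ r` of `q = exp (2 π i τ)`, with the branch determined by `τ`. -/
def qpow (τ : ℍ) (r : ℝ) : ℂ :=
  Complex.exp (2 * Real.pi * Complex.I * r * τ)

/-- The infinite `q`-Pochhammer symbol `(a; q)_∞ = ∏_{k ≥ 0} (1 - a q ^ k)`. -/
def qPochInf (a q : ℂ) : ℂ :=
  ∏' k : ℕ, (1 - a * q ^ k)

/-- The theta function `a(q) = - ∑_{n ∈ ℤ} (-1)^n q^{(14 n + 5)^2 / 56}`. -/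
def thetaA (τ : ℍ) : ℂ :=
  -∑' n : ℤ, (-1 : ℂ) ^ n * qpow τ ((14 * (n : ℝ) + 5) ^ 2 / 56)

/-- The theta function `b(q) = ∑_{n ∈ ℤ} (-1)^n q^{(14 n + 3)^2 / 56}`. -/
def thetaB (τ : ℍ) : ℂ :=
  ∑' n : ℤ, (-1 : ℂ) ^ n * qpow τ ((14 * (n : ℝ) + 3) ^ 2 / 56)

/-- The theta function `c(q) = ∑_{n ∈ ℤ} (-1)^n q^{(14 n + 1)^2 / 56}`. -/
def thetaC (τ : ℍ) : ℂ :=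
  ∑' n : ℤ, (-1 : ℂ) ^ n * qpow τ ((14 * (n : ℝ) + 1) ^ 2 / 56)

/-- The common factor `q^{7/8} (q^7; q^7)_∞^3`, where `q = exp (2 π i τ)`. -/
def factor (τ : ℍ) : ℂ :=
  qpow τ (7 / 8) * qPochInf (qpow τ 1 ^ 7) (qpow τ 1 ^ 7) ^ 3

/-- The septic parameter `x(q) = q^{7/8} (q^7; q^7)_∞^3 b(q) / c(q)^2`. -/
def paramX (τ : ℍ) : ℂ :=
  factor τ * (thetaB τ / thetaC τ ^ 2)

/-- The septic parameter `y(q) = - q^{7/8} (q^7; q^7)_∞^3 a(q) / b(q)^2`. -/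
def paramY (τ : ℍ) : ℂ :=
  -(factor τ * (thetaA τ / thetaB τ ^ 2))

/-- The septic parameter `z(q) = q^{7/8} (q^7; q^7)_∞^3 c(q) / a(q)^2`. -/
def paramZ (τ : ℍ) : ℂ :=
  factor τ * (thetaC τ / thetaA τ ^ 2)

/-- The normalized Eisenstein series of weight `2 k` (for `k ≥ 1`) as a function of `q`:
`E_{2k}(q) = 1 + 2 / ζ(1 - 2k) * ∑_{n ≥ 1} n^{2k-1} q^n / (1 - q^n)`. -/
def eisenstein (k : ℕ) (q : ℂ) : ℂ :=
  1 + 2 / riemannZeta (1 - 2 * (k : ℂ)) *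
    ∑' n : ℕ+, (n : ℂ) ^ (2 * k - 1) * q ^ (n : ℕ) / (1 - q ^ (n : ℕ))

end Septic

end

/-! Put `L = ℤ + 7τℤ`. On `ℂ/L` the point `τ` has order 7, and the invariants of `L` are, up to
powers of `2πi`, `E_4(q^7)` and `E_6(q^7)`. The septic parameters are coordinates for this point. By
the Jacobi triple product an odd theta function plays the role of the sigma function of `L`; at `jτ`
it takes the values `-a`, `b`, `c` up to powers of `q^{1/14}`. The sigma formulas for `℘(z) - ℘(v)`
and `℘'(v)` then give monomials in `x, y, z` (`weierstrassP_differences`,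
`derivWeierstrassP_values`).

Substituting the three points `τ, 2τ, 3τ` in `℘'² = 4℘³ - g₂℘ - g₃` and subtracting determines the
values of `℘`, then `g₂` and `g₃`: these are the formulas in `q^7`. For those in `q`, split `ℤ + τℤ`
into the cosets `jτ + L` (Vélu's formulas for the 7-isogeny). The sums of `(l - jτ)^{-4}` and `(l -
jτ)^{-6}` come from the second and fourth derivatives of `℘`, hence are polynomials in `℘(jτ), g₂,
g₃`. What is left is the algebra of `septic_elimination`. -/

open Filter Topology PeriodPair Complex
open scoped Real

/-! ### Finite q-binomial identities and the Jacobi triple product. -/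

/-- The reciprocal `1 / (q; q)_m` of the finite `q`-factorial, extended by zero to `m < 0`. -/
noncomputable def qFactInv (q : ℂ) (m : ℤ) : ℂ :=
  if 0 ≤ m then (∏ k ∈ Finset.range m.toNat, (1 - q ^ (k + 1)))⁻¹ else 0

theorem one_sub_pow_ne_zero {q : ℂ} (hq : ‖q‖ < 1) (k : ℕ) : 1 - q ^ (k + 1) ≠ 0 := by
  intro h
  have h1 : ‖q ^ (k + 1)‖ < 1 := by
    rw [norm_pow]; exact pow_lt_one₀ (norm_nonneg _) hq (by simp)
  rw [← sub_eq_zero.mp h] at h1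
  simp at h1

/-- The extension by zero makes this hold for every integer `m`: at `m = 0` the factor `1 - q^0`
vanishes. -/
theorem qFactInv_sub_one {q : ℂ} (hq : ‖q‖ < 1) (m : ℤ) :
    qFactInv q (m - 1) = (1 - q ^ m) * qFactInv q m := by
  rcases lt_trichotomy m 0 with h | rfl | h
  · simp [qFactInv, show ¬ 0 ≤ m by omega, show ¬ 1 ≤ m by omega]
  · simp [qFactInv]
  · obtain ⟨k, rfl⟩ : ∃ k : ℕ, m = k + 1 := ⟨(m - 1).toNat, by omega⟩
    have h1 : ((k : ℤ) + 1).toNat = k + 1 := by omega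
    have h2 := one_sub_pow_ne_zero hq k
    have h3 : q ^ ((k : ℤ) + 1) = q ^ (k + 1) := by norm_cast
    simp only [qFactInv, h1, add_sub_cancel_right, Int.toNat_natCast, Finset.prod_range_succ, h3]
    rw [if_pos (by positivity), if_pos (by positivity), mul_inv]
    field_simp

/-- The central `q`-binomial coefficients `[2n; n + j]_q`. -/
noncomputable def qCentral (q : ℂ) (n : ℕ) (j : ℤ) : ℂ :=
  (∏ k ∈ Finset.range (2 * n), (1 - q ^ (k + 1))) * qFactInv q (n + j) * qFactInv q (n - j)

/-- A two-step Pascal rule. Its three terms match those of `(1 - w q^n)(1 - w⁻¹ q^{n+1}) = (1 +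
q^{2n+1}) - w q^n - w⁻¹ q^{n+1}`, the last two shifting `j`. -/
theorem qCentral_succ {q : ℂ} (hq : ‖q‖ < 1) (h0 : q ≠ 0) (n : ℕ) (j : ℤ) :
    qCentral q (n + 1) j = (1 + q ^ (2 * n + 1)) * qCentral q n j
      + q ^ (n - j + 1) * qCentral q n (j - 1) + q ^ (n + 1 + j) * qCentral q n (j + 1) := by
  have e1 : qFactInv q (n + j) = (1 - q ^ (n + 1 + j)) * qFactInv q (n + 1 + j) := by
    rw [← qFactInv_sub_one hq]; congr 1; ring
  have e2 : qFactInv q (n - j) = (1 - q ^ (n - j + 1)) * qFactInv q (n - j + 1) := by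
    rw [← qFactInv_sub_one hq]; congr 1; ring
  have e3 : qFactInv q (n + (j - 1)) = (1 - q ^ (n + j)) * qFactInv q (n + j) := by
    rw [← qFactInv_sub_one hq]; congr 1; ring
  have e4 : qFactInv q (n - (j + 1)) = (1 - q ^ (n - j)) * qFactInv q (n - j) := by
    rw [← qFactInv_sub_one hq]; congr 1; ring
  have e5 : (((n + 1 : ℕ) : ℤ) + j) = n + 1 + j := by push_cast; ring
  have e6 : (((n + 1 : ℕ) : ℤ) - j) = n - j + 1 := by push_cast; ring
  have e7 : (n : ℤ) - (j - 1) = n - j + 1 := by ring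
  have e8 : (n : ℤ) + (j + 1) = n + 1 + j := by ring
  have q1 : q ^ (n + 1 + j : ℤ) = q ^ (n + j : ℤ) * q := by
    rw [← zpow_add_one₀ h0]; congr 1; ring
  have q2 : q ^ (n - j + 1 : ℤ) = q ^ (n - j : ℤ) * q := by
    rw [← zpow_add_one₀ h0]
  have q3 : q ^ (2 * n) = q ^ (n + j : ℤ) * q ^ (n - j : ℤ) := by
    rw [← zpow_add₀ h0, ← zpow_natCast]; congr 1; push_cast; ring
  simp only [qCentral, e5, e6, e7, e8, e3, e4]
  rw [e1, e2, show 2 * (n + 1) = 2 * n + 1 + 1 by ring, Finset.prod_range_succ,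
    Finset.prod_range_succ, q1, q2, pow_succ q (2 * n + 1), pow_succ q (2 * n), q3]
  ring

/-- The recursion on `u` stands for `u j = (-w)^j q^{j(j-1)/2}`; it avoids triangular exponents and
can be checked directly on the terms of a theta series. -/
theorem hasSum_finite_tripleProduct {q w : ℂ} (hq : ‖q‖ < 1) (h0 : q ≠ 0) (hw : w ≠ 0)
    {u : ℤ → ℂ} (u0 : u 0 = 1) (hu : ∀ j, u (j + 1) = -w * q ^ j * u j) (n : ℕ) :
    HasSum (fun j ↦ u j * qCentral q n j)
      (∏ k ∈ Finset.range n, ((1 - w * q ^ k) * (1 - w⁻¹ * q ^ (k + 1)))) := by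
  induction n with
  | zero =>
    rw [Finset.prod_range_zero]
    convert hasSum_ite_eq (0 : ℤ) (1 : ℂ) using 2 with j
    split_ifs with h
    · simp [h, qCentral, qFactInv, u0]
    · rcases lt_or_gt_of_ne h with h | h
      · simp [qCentral, qFactInv, show ¬ 0 ≤ j by omega]
      · simp [qCentral, qFactInv, show ¬ j ≤ 0 by omega]
  | succ n ih =>
    have h1 := (Equiv.subRight (1 : ℤ)).hasSum_iff.mpr ih
    have h2 := (Equiv.addRight (1 : ℤ)).hasSum_iff.mpr ih
    have h3 := ((ih.mul_left (1 + q ^ (2 * n + 1))).add (h1.mul_left (-w * q ^ n))).add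
      (h2.mul_left (-w⁻¹ * q ^ (n + 1)))
    convert! h3 using 1
    · funext j
      have r1 := hu (j - 1)
      rw [sub_add_cancel] at r1
      have q2 : q ^ (n - j + 1 : ℤ) * q ^ (j - 1) = q ^ n := by
        rw [← zpow_add₀ h0, ← zpow_natCast]; congr 1; ring
      have q1 : q ^ (n + 1 + j : ℤ) = q ^ (n + 1) * q ^ j := by
        rw [zpow_add₀ h0]; norm_cast
      rw [qCentral_succ hq h0]
      simp only [Function.comp_apply, Equiv.subRight_apply, Equiv.coe_addRight, hu j, q1]
      rw [← q2, r1]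
      field_simp
      ring
    · rw [Finset.prod_range_succ]
      field_simp
      ring

theorem tendsto_prod_one_sub_mul_pow {q : ℂ} (hq : ‖q‖ < 1) (a : ℂ) :
    Tendsto (fun n ↦ ∏ k ∈ Finset.range n, (1 - a * q ^ k)) atTop
      (𝓝 (∏' k : ℕ, (1 - a * q ^ k))) := by
  apply Multipliable.tendsto_prod_tprod_nat
  simp_rw [sub_eq_add_neg]
  apply multipliable_one_add_of_summable
  simpa using (summable_geometric_of_lt_one (norm_nonneg _) hq).mul_left _

theorem tprod_one_sub_mul_pow_ne_zero {q a : ℂ} (hq : ‖q‖ < 1) (ha : ∀ k, a * q ^ k ≠ 1) :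
    ∏' k : ℕ, (1 - a * q ^ k) ≠ 0 := by
  simp_rw [sub_eq_add_neg]
  apply tprod_one_add_ne_zero_of_summable
  · intro k h
    exact ha k (by linear_combination -h)
  · simpa using (summable_geometric_of_lt_one (norm_nonneg _) hq).mul_left _

theorem exists_norm_le_of_tendsto {f : ℕ → ℂ} {l : ℂ} (h : Tendsto f atTop (𝓝 l)) :
    ∃ C, 0 ≤ C ∧ ∀ n, ‖f n‖ ≤ C := by
  obtain ⟨C, hC⟩ := (Metric.isBounded_range_of_tendsto f h).exists_norm_le
  exact ⟨C, (norm_nonneg _).trans (hC _ ⟨0, rfl⟩), fun n ↦ hC _ ⟨n, rfl⟩⟩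

/-- The Jacobi triple product identity. -/
theorem tsum_eq_tripleProduct {q w : ℂ} (hq : ‖q‖ < 1) (h0 : q ≠ 0) (hw : w ≠ 0)
    {u : ℤ → ℂ} (u0 : u 0 = 1) (hu : ∀ j, u (j + 1) = -w * q ^ j * u j) (hs : Summable u) :
    ∑' j, u j = (∏' k : ℕ, (1 - q * q ^ k)) *
      ((∏' k : ℕ, (1 - w * q ^ k)) * ∏' k : ℕ, (1 - w⁻¹ * q * q ^ k)) := by
  set P := ∏' k : ℕ, (1 - q * q ^ k) with hP
  have hPne : P ≠ 0 := tprod_one_sub_mul_pow_ne_zero hq fun k h ↦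
    one_sub_pow_ne_zero hq k (by rw [pow_succ', h, sub_self])
  have hfac : Tendsto (fun n ↦ ∏ k ∈ Finset.range n, (1 - q ^ (k + 1))) atTop (𝓝 P) := by
    simpa only [pow_succ'] using tendsto_prod_one_sub_mul_pow hq q
  have hinv := hfac.inv₀ hPne
  obtain ⟨A, hA0, hA⟩ := exists_norm_le_of_tendsto hfac
  obtain ⟨B, hB0, hB⟩ := exists_norm_le_of_tendsto hinv
  have hB' (m : ℤ) : ‖qFactInv q m‖ ≤ B := by
    unfold qFactInv
    split_ifs
    · exact hB _
    · simpa
  have hc (j : ℤ) : Tendsto (fun n : ℕ ↦ qCentral q n j) atTop (𝓝 P⁻¹) := by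
    have t1 : Tendsto (fun n : ℕ ↦ 2 * n) atTop atTop :=
      tendsto_id.const_mul_atTop' (by norm_num)
    have key (i : ℤ) : Tendsto (fun n : ℕ ↦ qFactInv q (n + i)) atTop (𝓝 P⁻¹) := by
      have t2 : Tendsto (fun n : ℕ ↦ ((n : ℤ) + i).toNat) atTop atTop := by
        refine tendsto_atTop.mpr fun b ↦ ?_
        filter_upwards [eventually_ge_atTop (b + i.natAbs)] with n hn
        omega
      refine (hinv.comp t2).congr' ?_
      filter_upwards [eventually_ge_atTop i.natAbs] with n hn
      simp [qFactInv, show 0 ≤ (n : ℤ) + i by omega]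
    have := ((hfac.comp t1).mul (key j)).mul (key (-j))
    rw [mul_inv_cancel₀ hPne, one_mul] at this
    exact this
  -- Each central coefficient tends to `P · P⁻¹ · P⁻¹`, and all are bounded by `A B B`, so the limit
  -- passes through the sum.
  have hlim := tendsto_tsum_of_dominated_convergence (𝓕 := atTop)
    (f := fun n j ↦ u j * qCentral q n j) (g := fun j ↦ u j * P⁻¹)
    (bound := fun j ↦ ‖u j‖ * (A * B * B)) (hs.norm.mul_right _)
    (fun j ↦ (hc j).const_mul _) (Eventually.of_forall fun n j ↦ by
      rw [norm_mul, qCentral, norm_mul, norm_mul]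
      gcongr
      exacts [hA _, hB' _, hB' _])
  simp_rw [(hasSum_finite_tripleProduct hq h0 hw u0 hu _).tsum_eq, Finset.prod_mul_distrib,
    tsum_mul_right] at hlim
  have hlim2 := (tendsto_prod_one_sub_mul_pow hq w).mul
    (tendsto_prod_one_sub_mul_pow hq (w⁻¹ * q))
  simp_rw [mul_assoc w⁻¹ q, ← pow_succ'] at hlim2
  have := tendsto_nhds_unique hlim hlim2
  simp_rw [mul_assoc w⁻¹ q, ← pow_succ', ← this]
  field_simp

/-! ### Sigma-function formulas for `℘` and `℘'`. -/

theorem Complex.differentiable_dslope {f : ℂ → ℂ} (hf : Differentiable ℂ f) (c : ℂ) :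
    Differentiable ℂ (dslope f c) := by
  rw [← differentiableOn_univ] at hf ⊢
  exact (Complex.differentiableOn_dslope univ_mem).mpr hf

theorem deriv_zero_of_even {f : ℂ → ℂ} (hf : ∀ z, f (-z) = f z) : deriv f 0 = 0 := by
  have h := deriv_comp_neg (f := f) (x := 0)
  simp only [hf, neg_zero] at h
  linear_combination h / 2

section Sigma

variable (L : PeriodPair) {θ : ℂ → ℂ} (hθ : Differentiable ℂ θ) (hodd : ∀ z, θ (-z) = -θ z)
  (hD : deriv θ 0 ≠ 0) (hzero : ∀ z, θ z = 0 → z ∈ L.lattice)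
  (hper : ∀ l ∈ L.lattice, ∃ a b : ℂ, ∀ z, θ (z + l) = Complex.exp (a * z + b) * θ z)

include hθ hodd hD hzero hper in
/-- The difference of two values of `℘` in terms of a sigma-like function `θ`. -/
theorem PeriodPair.weierstrassP_sub {z v : ℂ} (hz : z ∉ L.lattice) (hv : v ∉ L.lattice) :
    ℘[L] z - ℘[L] v =
      -(deriv θ 0 ^ 2 * (θ (z + v) * θ (z - v)) / (θ z ^ 2 * θ v ^ 2)) := by
  classical
  have hθ0 : θ 0 = 0 := by
    have := hodd 0
    rw [neg_zero] at this
    linear_combination this / 2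
  have hne {w : ℂ} (hw : w ∉ L.lattice) : θ w ≠ 0 := fun h ↦ hw (hzero w h)
  have hθv := hne hv
  set D := deriv θ 0 with hDdef
  set u := dslope θ 0 with hu
  have hud : Differentiable ℂ u := Complex.differentiable_dslope hθ 0
  have hθu (w : ℂ) : θ w = w * u w := by
    have := sub_smul_dslope θ 0 w
    simpa [hθ0] using this.symm
  have hu0 : u 0 = D := dslope_same θ 0
  have hueven (w : ℂ) : u (-w) = u w := by
    rcases eq_or_ne w 0 with rfl | hw
    · simp
    · have h1 := hθu (-w)
      rw [hodd, hθu w] at h1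
      exact mul_left_cancel₀ hw (by linear_combination h1)
  -- With `θ w = w u(w)`, the polar part at 0 of the difference of the two sides is `M w / (w²
  -- u(w)²)`. As `M` is even and `M 0 = -D² + D² = 0`, it is divisible by `w²`, so the poles cancel.
  set M : ℂ → ℂ := fun w ↦ D ^ 2 * (θ (w + v) * θ (w - v)) / θ v ^ 2 + u w ^ 2 with hM
  have hMd : Differentiable ℂ M := by
    have h1 : Differentiable ℂ fun w ↦ θ (w + v) := hθ.comp (by fun_prop)
    have h2 : Differentiable ℂ fun w ↦ θ (w - v) := hθ.comp (by fun_prop)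
    fun_prop
  have hMeven (w : ℂ) : M (-w) = M w := by
    simp only [hM, hueven]
    rw [show -w + v = -(w - v) by ring, show -w - v = -(w + v) by ring, hodd, hodd]
    ring
  have hM0 : M 0 = 0 := by
    simp only [hM, zero_add, zero_sub, hodd, hu0]
    field_simp
    ring
  set M₁ := dslope M 0 with hM1
  have hM1d : Differentiable ℂ M₁ := Complex.differentiable_dslope hMd 0
  set M₂ := dslope M₁ 0 with hM2
  have hM2d : Differentiable ℂ M₂ := Complex.differentiable_dslope hM1d 0
  have hMM (w : ℂ) : M w = w ^ 2 * M₂ w := by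
    have h1 := sub_smul_dslope M 0 w
    have h2 := sub_smul_dslope M₁ 0 w
    have h3 : M₁ 0 = 0 := (dslope_same M 0).trans (deriv_zero_of_even hMeven)
    simp only [sub_zero, hM0, smul_eq_mul, h3, ← hM1, ← hM2] at h1 h2
    rw [← h1, ← h2]
    ring
  set e : ℂ → ℂ := fun w ↦ ℘[L - (0 : ℂ)] w - ℘[L] v + M₂ w / u w ^ 2 with he
  set f : ℂ → ℂ := fun w ↦ ℘[L] w - ℘[L] v
    + D ^ 2 * (θ (w + v) * θ (w - v)) / (θ w ^ 2 * θ v ^ 2) with hf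
  have hef {w : ℂ} (hw : w ∉ L.lattice) : f w = e w := by
    have hw0 : w ≠ 0 := fun h ↦ hw (h ▸ zero_mem _)
    have h1 := L.weierstrassPExcept_add 0 w
    have h2 : u w ≠ 0 := fun h ↦ hne hw (by rw [hθu, h, mul_zero])
    have h3 := hMM w
    simp only [ZeroMemClass.coe_zero, sub_zero] at h1
    simp only [hM] at h3
    simp only [he, hf, ← h1, hθu w]
    have h4 : M₂ w = (D ^ 2 * (θ (w + v) * θ (w - v)) / θ v ^ 2 + u w ^ 2) / w ^ 2 := by
      rw [h3]; field_simp
    rw [h4]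
    field_simp
    ring
  -- The extension of `f` across its removable singularities. Periodicity reduces every lattice
  -- point to 0; an entire elliptic function is bounded, hence constant, and at `v` it vanishes
  -- because `θ 0 = 0`.
  set g : ℂ → ℂ := fun w ↦ if w ∈ L.lattice then e 0 else f w with hg
  have hgper (w l : ℂ) (hl : l ∈ L.lattice) : g (w + l) = g w := by
    have hmem : w + l ∈ L.lattice ↔ w ∈ L.lattice :=
      L.lattice.toAddSubgroup.add_mem_cancel_right (y := w) hl
    simp only [hg, hmem]
    split_ifs with hw
    · rfl
    · obtain ⟨a, b, hab⟩ := hper l hl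
      have h1 : ℘[L] (w + l) = ℘[L] w := L.weierstrassP_add_coe w ⟨l, hl⟩
      have h2 := hne hw
      simp only [hf, h1]
      rw [show w + l + v = (w + v) + l by ring, show w + l - v = (w - v) + l by ring, hab, hab,
        hab, show a * (w + v) + b = (a * w + b) + a * v by ring,
        show a * (w - v) + b = (a * w + b) - a * v by ring, Complex.exp_add, Complex.exp_sub]
      have h3 := Complex.exp_ne_zero (a * w + b)
      have h4 := Complex.exp_ne_zero (a * v)
      field_simp
  have hg0 : DifferentiableAt ℂ g 0 := by
    have h1 : DifferentiableAt ℂ e 0 := by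
      have h2 : DifferentiableAt ℂ ℘[L - (0 : ℂ)] 0 :=
        (L.analyticAt_weierstrassPExcept 0).differentiableAt
      have h3 := hM2d 0
      have h4 := hud 0
      refine (h2.sub_const _).add (h3.div (h4.pow 2) ?_)
      simpa [hu0] using hD
    refine h1.congr_of_eventuallyEq ?_
    filter_upwards [L.compl_lattice_sdiff_singleton_mem_nhds 0] with w hw
    by_cases hw0 : w = 0
    · simp [hg, hw0]
    · have : w ∉ L.lattice := fun h ↦ hw ⟨h, hw0⟩
      simp only [hg, if_neg this, hef this]
  have hgd : Differentiable ℂ g := by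
    intro w
    by_cases hw : w ∈ L.lattice
    · have h1 : g = fun t ↦ g (t + -w) := funext fun t ↦ (hgper t (-w) (neg_mem hw)).symm
      rw [h1]
      refine DifferentiableAt.comp w (f := fun t ↦ t + -w) (g := g) ?_ (by fun_prop)
      simpa using hg0
    · have h1 : DifferentiableAt ℂ f w := by
        have h2 : DifferentiableAt ℂ ℘[L] w := (L.analyticOnNhd_weierstrassP w hw).differentiableAt
        have h3 : Differentiable ℂ fun w ↦ θ (w + v) := hθ.comp (by fun_prop)
        have h4 : Differentiable ℂ fun w ↦ θ (w - v) := hθ.comp (by fun_prop)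
        refine (h2.sub_const _).add (((h3 w).mul (h4 w) |>.const_mul _).div
          (((hθ w).pow 2).mul_const _) ?_)
        exact mul_ne_zero (pow_ne_zero _ (hne hw)) (pow_ne_zero _ hθv)
      refine h1.congr_of_eventuallyEq ?_
      filter_upwards [L.isClosed_lattice.isOpen_compl.mem_nhds hw] with t ht
      have : t ∉ L.lattice := ht
      simp [hg, this]
  have hconst := hgd.apply_eq_apply_of_bounded
    (IsZLattice.isCompact_range_of_periodic L.lattice g hgd.continuous hgper).isBounded z v
  simp only [hg, hz, hv, if_false, hf, sub_self, hθ0, mul_zero, zero_div, add_zero] at hconst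
  linear_combination hconst

-- Near `v`, `℘ z - ℘ v` is `k z · θ (z - v)`. Since `θ 0 = 0`, its derivative at `v` is `k v ·
-- θ'(0)`.
include hθ hodd hD hzero hper in
theorem PeriodPair.derivWeierstrassP_eq {v : ℂ} (hv : v ∉ L.lattice) :
    ℘'[L] v = -(deriv θ 0 ^ 3 * θ (2 * v) / θ v ^ 4) := by
  have hθv : θ v ≠ 0 := fun h ↦ hv (hzero v h)
  have hθ0 : θ 0 = 0 := by
    have := hodd 0
    rw [neg_zero] at this
    linear_combination this / 2
  set k : ℂ → ℂ := fun z ↦ -(deriv θ 0 ^ 2 * θ (z + v) / (θ z ^ 2 * θ v ^ 2)) with hk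
  have hkd : DifferentiableAt ℂ k v := by
    have h3 : Differentiable ℂ fun w ↦ θ (w + v) := hθ.comp (by fun_prop)
    exact (((h3 v).const_mul _).div (((hθ v).pow 2).mul_const _)
      (mul_ne_zero (pow_ne_zero _ hθv) (pow_ne_zero _ hθv))).neg
  have h1 : HasDerivAt (fun z ↦ θ (z - v)) (deriv θ 0) v := by
    have : HasDerivAt θ (deriv θ 0) (v - v) := by rw [sub_self]; exact (hθ 0).hasDerivAt
    exact this.comp_sub_const v v
  have h2 := (hkd.hasDerivAt.mul h1).add_const (℘[L] v)
  have h4 : ℘[L] =ᶠ[𝓝 v] fun z ↦ (k * fun z ↦ θ (z - v)) z + ℘[L] v := by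
    filter_upwards [L.isClosed_lattice.isOpen_compl.mem_nhds hv] with z hz
    have := L.weierstrassP_sub hθ hodd hD hzero hper hz hv
    simp only [Pi.mul_apply, hk]
    linear_combination this
  rw [← L.deriv_weierstrassP, (h2.congr_of_eventuallyEq h4).deriv, sub_self, hθ0, hk]
  simp only [two_mul]
  field_simp
  ring

end Sigma

/-! ### Infinite products and the odd theta function. -/

section EulerProduct

theorem tprod_one_sub_mul_pow_eq {q : ℂ} (hq : ‖q‖ < 1) (a : ℂ) :
    ∏' k : ℕ, (1 - a * q ^ k) = (1 - a) * ∏' k : ℕ, (1 - a * q * q ^ k) := by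
  have h1 := (tendsto_prod_one_sub_mul_pow hq a).comp (tendsto_add_atTop_nat 1)
  have h2 := (tendsto_prod_one_sub_mul_pow hq (a * q)).const_mul (1 - a)
  refine tendsto_nhds_unique h1 (h2.congr fun n ↦ ?_)
  simp only [Function.comp_apply, Finset.prod_range_succ', pow_zero, mul_one, mul_comm (1 - a),
    mul_assoc, pow_succ']

theorem differentiable_tprod_one_sub_mul_pow {q : ℂ} (hq : ‖q‖ < 1) :
    Differentiable ℂ fun a : ℂ ↦ ∏' k : ℕ, (1 - a * q ^ k) := by
  intro a
  have hs : Summable fun n : ℕ ↦ (‖a‖ + 1) * ‖q‖ ^ n :=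
    (summable_geometric_of_lt_one (norm_nonneg _) hq).mul_left _
  have h1 : HasProdLocallyUniformlyOn (fun (n : ℕ) (b : ℂ) ↦ 1 + -(b * q ^ n))
      (fun b ↦ ∏' n : ℕ, (1 + -(b * q ^ n))) (Metric.ball 0 (‖a‖ + 1)) := by
    refine hs.hasProdLocallyUniformlyOn_nat_one_add Metric.isOpen_ball
      (.of_forall fun n b hb ↦ ?_) (fun n ↦ by fun_prop)
    rw [norm_neg, norm_mul, norm_pow]
    gcongr
    exact (mem_ball_zero_iff.mp hb).le
  simp_rw [sub_eq_add_neg]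
  refine (h1.differentiableOn (.of_forall fun s ↦ ?_) Metric.isOpen_ball).differentiableAt
    (Metric.isOpen_ball.mem_nhds (by simp))
  simpa [Finset.prod_fn] using DifferentiableOn.finsetProd (fun _ _ ↦ by fun_prop)

end EulerProduct

/-- The odd Jacobi theta function `-∑ (-1)^n exp (π i (n + 1/2)² τ + 2 π i (n + 1/2) z)`. -/
noncomputable def oddTheta (τ z : ℂ) : ℂ :=
  -cexp (π * I * τ / 4 + π * I * z) * jacobiTheta₂ (z + τ / 2 + 1 / 2) τ

section OddTheta

variable {τ : ℂ}

theorem norm_exp_two_pi_I_mul_lt_one (hτ : 0 < τ.im) : ‖cexp (2 * π * I * τ)‖ < 1 :=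
  UpperHalfPlane.norm_exp_two_pi_I_lt_one ⟨τ, hτ⟩

theorem differentiable_oddTheta (hτ : 0 < τ.im) : Differentiable ℂ (oddTheta τ) := by
  intro z
  have h : DifferentiableAt ℂ (fun w ↦ jacobiTheta₂ (w + τ / 2 + 1 / 2) τ) z :=
    DifferentiableAt.comp z (differentiableAt_jacobiTheta₂_fst _ hτ) (by fun_prop)
  unfold oddTheta
  fun_prop

theorem oddTheta_neg (τ z : ℂ) : oddTheta τ (-z) = -oddTheta τ z := by
  have h1 : jacobiTheta₂ (-z + τ / 2 + 1 / 2) τ = jacobiTheta₂ (z - τ / 2 - 1 / 2) τ := by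
    rw [← jacobiTheta₂_neg_left]; congr 1; ring
  have h2 : jacobiTheta₂ (z + τ / 2 + 1 / 2) τ =
      cexp (-π * I * (τ + 2 * (z - τ / 2 - 1 / 2))) * jacobiTheta₂ (z - τ / 2 - 1 / 2) τ := by
    rw [← jacobiTheta₂_add_left', ← jacobiTheta₂_add_left (_ + τ)]; congr 1; ring
  have h3 : cexp (π * I * τ / 4 + π * I * -z) =
      -(cexp (π * I * τ / 4 + π * I * z) * cexp (-π * I * (τ + 2 * (z - τ / 2 - 1 / 2)))) := by
    rw [← Complex.exp_add, show π * I * τ / 4 + π * I * -z = π * I * τ / 4 + π * I * z +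
      -π * I * (τ + 2 * (z - τ / 2 - 1 / 2)) - π * I by ring, Complex.exp_sub _ (π * I),
      Complex.exp_pi_mul_I, div_neg, div_one]
  rw [oddTheta, oddTheta, h1, h2, h3]
  ring

/-- The multiplier is just `-1`, written in the shape that `hper` asks for. -/
theorem oddTheta_add_one (τ z : ℂ) : oddTheta τ (z + 1) = cexp (0 * z + π * I) * oddTheta τ z := by
  have h2 : jacobiTheta₂ (z + 1 + τ / 2 + 1 / 2) τ = jacobiTheta₂ (z + τ / 2 + 1 / 2) τ := by
    rw [← jacobiTheta₂_add_left (z + τ / 2 + 1 / 2)]; congr 1; ring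
  rw [oddTheta, oddTheta, h2, show π * I * τ / 4 + π * I * (z + 1) =
    (0 * z + π * I) + (π * I * τ / 4 + π * I * z) by ring, Complex.exp_add]
  ring

theorem oddTheta_add_self (τ z : ℂ) :
    oddTheta τ (z + τ) = cexp (-2 * π * I * z + (-π * I * τ - π * I)) * oddTheta τ z := by
  have h2 : jacobiTheta₂ (z + τ + τ / 2 + 1 / 2) τ =
      cexp (-π * I * (τ + 2 * (z + τ / 2 + 1 / 2))) * jacobiTheta₂ (z + τ / 2 + 1 / 2) τ := by
    rw [← jacobiTheta₂_add_left']; congr 1; ring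
  have h3 : cexp (π * I * τ / 4 + π * I * (z + τ)) *
      cexp (-π * I * (τ + 2 * (z + τ / 2 + 1 / 2))) =
      cexp (-2 * π * I * z + (-π * I * τ - π * I)) * cexp (π * I * τ / 4 + π * I * z) := by
    rw [← Complex.exp_add, ← Complex.exp_add]; congr 1; ring
  rw [oddTheta, oddTheta, h2]
  linear_combination -jacobiTheta₂ (z + τ / 2 + 1 / 2) τ * h3

theorem oddTheta_eq_tprod (hτ : 0 < τ.im) {q : ℂ} (hq : q = cexp (2 * π * I * τ)) (z : ℂ) :
    oddTheta τ z = (cexp (-(π * I * z)) - cexp (π * I * z)) * (cexp (π * I * τ / 4) *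
      (∏' k : ℕ, (1 - q * q ^ k)) * (∏' k : ℕ, (1 - cexp (2 * π * I * z) * q * q ^ k)) *
        ∏' k : ℕ, (1 - cexp (-(2 * π * I * z)) * q * q ^ k)) := by
  have hq1 : ‖q‖ < 1 := hq ▸ norm_exp_two_pi_I_mul_lt_one hτ
  have hq0 : q ≠ 0 := hq ▸ Complex.exp_ne_zero _
  have key := tsum_eq_tripleProduct (w := cexp (2 * π * I * z) * q) hq1 hq0
    (mul_ne_zero (Complex.exp_ne_zero _) hq0)
    (u := fun n ↦ jacobiTheta₂_term n (z + τ / 2 + 1 / 2) τ) (by simp [jacobiTheta₂_term])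
    (fun j ↦ by
      simp only [jacobiTheta₂_term]
      rw [hq, ← Complex.exp_int_mul, neg_mul, neg_mul, ← neg_one_mul, ← Complex.exp_pi_mul_I,
        ← Complex.exp_add, ← Complex.exp_add, ← Complex.exp_add, ← Complex.exp_add]
      congr 1
      push_cast
      ring)
    ((summable_jacobiTheta₂_term_iff _ _).mpr hτ)
  have h1 : (cexp (2 * π * I * z) * q)⁻¹ * q = cexp (-(2 * π * I * z)) := by
    rw [Complex.exp_neg]; field_simp
  -- Splitting off the `k = 0` factor isolates the simple zero at `z = 0`.
  rw [h1, tprod_one_sub_mul_pow_eq hq1 (cexp (-(2 * π * I * z)))] at key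
  have h2 : -cexp (π * I * τ / 4 + π * I * z) * (1 - cexp (-(2 * π * I * z))) =
      (cexp (-(π * I * z)) - cexp (π * I * z)) * cexp (π * I * τ / 4) := by
    rw [mul_sub, neg_mul, neg_mul, sub_mul, ← Complex.exp_add, ← Complex.exp_add,
      ← Complex.exp_add, show π * I * τ / 4 + π * I * z + -(2 * π * I * z) =
        -(π * I * z) + π * I * τ / 4 by ring, add_comm (π * I * z)]
    ring
  rw [oddTheta, jacobiTheta₂, key]
  linear_combination ((∏' k : ℕ, (1 - q * q ^ k)) *
    (∏' k : ℕ, (1 - cexp (2 * π * I * z) * q * q ^ k)) *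
      ∏' k : ℕ, (1 - cexp (-(2 * π * I * z)) * q * q ^ k)) * h2

/-- Only `e^{-πiz} - e^{πiz}` vanishes at 0, and there the three infinite products coincide; hence
the cube in `Septic.factor`. -/
theorem deriv_oddTheta_zero (hτ : 0 < τ.im) {q : ℂ} (hq : q = cexp (2 * π * I * τ)) :
    deriv (oddTheta τ) 0 =
      -(2 * π * I) * (cexp (π * I * τ / 4) * (∏' k : ℕ, (1 - q * q ^ k)) ^ 3) := by
  have hq1 : ‖q‖ < 1 := hq ▸ norm_exp_two_pi_I_mul_lt_one hτ
  have hG := differentiable_tprod_one_sub_mul_pow hq1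
  have h1 : DifferentiableAt ℂ (fun z ↦ ∏' k : ℕ, (1 - cexp (2 * π * I * z) * q * q ^ k)) 0 :=
    DifferentiableAt.comp (0 : ℂ) (hG _) (f := fun z ↦ cexp (2 * π * I * z) * q) (by fun_prop)
  have h2 : DifferentiableAt ℂ (fun z ↦ ∏' k : ℕ, (1 - cexp (-(2 * π * I * z)) * q * q ^ k)) 0 :=
    DifferentiableAt.comp (0 : ℂ) (hG _) (f := fun z ↦ cexp (-(2 * π * I * z)) * q) (by fun_prop)
  have h3 := (h1.const_mul (cexp (π * I * τ / 4) * (∏' k : ℕ, (1 - q * q ^ k)))).mul h2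
  have h4 : HasDerivAt (fun z : ℂ ↦ cexp (-(π * I * z)) - cexp (π * I * z)) (-(2 * π * I)) 0 := by
    have e : HasDerivAt (fun z : ℂ ↦ π * I * z) (π * I) 0 := by
      simpa using (hasDerivAt_id (0 : ℂ)).const_mul (π * I)
    convert! e.neg.cexp.sub e.cexp using 1
    simp
    ring
  have h5 := h4.mul h3.hasDerivAt
  rw [funext (oddTheta_eq_tprod hτ hq)]
  refine h5.deriv.trans ?_
  simp
  ring

theorem deriv_oddTheta_zero_ne_zero (hτ : 0 < τ.im) : deriv (oddTheta τ) 0 ≠ 0 := by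
  have hq1 := norm_exp_two_pi_I_mul_lt_one hτ
  rw [deriv_oddTheta_zero hτ rfl]
  refine mul_ne_zero (by simp [Real.pi_ne_zero]) (mul_ne_zero (Complex.exp_ne_zero _)
    (pow_ne_zero _ (tprod_one_sub_mul_pow_ne_zero hq1 fun k h ↦ one_sub_pow_ne_zero hq1 k ?_)))
  rw [pow_succ', h, sub_self]

theorem exists_int_of_oddTheta_eq_zero (hτ : 0 < τ.im) {z : ℂ} (h : oddTheta τ z = 0) :
    ∃ m n : ℤ, m * 1 + n * τ = z := by
  have hq1 := norm_exp_two_pi_I_mul_lt_one hτ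
  have hI : (2 * π * I : ℂ) ≠ 0 := by simp [Real.pi_ne_zero]
  have key (n : ℤ) (h : cexp (2 * π * I * z) = cexp (n * (2 * π * I * τ))) :
      ∃ m n : ℤ, m * 1 + n * τ = z := by
    obtain ⟨m, hm⟩ := Complex.exp_eq_exp_iff_exists_int.mp h
    exact ⟨m, n, mul_left_cancel₀ hI (by linear_combination -hm)⟩
  by_contra hz
  have hne (n : ℤ) (h : cexp (2 * π * I * z) = cexp (n * (2 * π * I * τ))) : False := hz (key n h)
  rw [oddTheta_eq_tprod hτ rfl] at h
  have h0 := (mul_ne_zero_iff.mp (deriv_oddTheta_zero hτ rfl ▸ deriv_oddTheta_zero_ne_zero hτ)).2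
  refine mul_ne_zero ?_ (mul_ne_zero (mul_ne_zero (mul_ne_zero (Complex.exp_ne_zero _) ?_) ?_) ?_) h
  · intro h
    rw [sub_eq_zero, Complex.exp_eq_exp_iff_exists_int] at h
    obtain ⟨n, hn⟩ := h
    refine hne 0 (Complex.exp_eq_exp_iff_exists_int.mpr ⟨-n, ?_⟩)
    push_cast
    linear_combination -hn
  · exact pow_ne_zero_iff (by norm_num) |>.mp (mul_ne_zero_iff.mp h0).2
  · refine tprod_one_sub_mul_pow_ne_zero hq1 fun k hk ↦ hne (-(k + 1)) ?_
    rw [← Complex.exp_nat_mul, ← Complex.exp_add, ← Complex.exp_add] at hk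
    obtain ⟨n, hn⟩ := Complex.exp_eq_one_iff.mp hk
    refine Complex.exp_eq_exp_iff_exists_int.mpr ⟨n, ?_⟩
    push_cast
    linear_combination hn
  · refine tprod_one_sub_mul_pow_ne_zero hq1 fun k hk ↦ hne (k + 1) ?_
    rw [← Complex.exp_nat_mul, ← Complex.exp_add, ← Complex.exp_add] at hk
    obtain ⟨n, hn⟩ := Complex.exp_eq_one_iff.mp hk
    refine Complex.exp_eq_exp_iff_exists_int.mpr ⟨-n, ?_⟩
    push_cast
    linear_combination -hn

end OddTheta

/-! ### The lattice `ℤ + τℤ` and quasi-periodicity of theta. -/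

/-- The pair of periods `1, τ`. -/
noncomputable def upperPeriodPair (τ : ℂ) (hτ : 0 < τ.im) : PeriodPair where
  ω₁ := 1
  ω₂ := τ
  indep := by
    rw [LinearIndependent.pair_iff]
    intro s t h
    have h1 := congrArg Complex.im h
    have h2 := congrArg Complex.re h
    simp at h1 h2
    have ht : t = 0 := h1.resolve_right hτ.ne'
    exact ⟨by simpa [ht] using h2, ht⟩

section PeriodPair

variable {τ : ℂ} (hτ : 0 < τ.im)

theorem mem_upperPeriodPair_lattice {z : ℂ} :
    z ∈ (upperPeriodPair τ hτ).lattice ↔ ∃ m n : ℤ, m * 1 + n * τ = z :=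
  PeriodPair.mem_lattice

/-- The translations with an exponential multiplier form a subgroup, which contains `1` and `τ`. -/
theorem exists_oddTheta_add_eq {l : ℂ} (hl : l ∈ (upperPeriodPair τ hτ).lattice) :
    ∃ a b : ℂ, ∀ z, oddTheta τ (z + l) = cexp (a * z + b) * oddTheta τ z := by
  let S : AddSubgroup ℂ :=
    { carrier := {l | ∃ a b : ℂ, ∀ z, oddTheta τ (z + l) = cexp (a * z + b) * oddTheta τ z}
      zero_mem' := ⟨0, 0, by simp⟩
      add_mem' := by
        rintro l m ⟨a, b, h⟩ ⟨c, d, h'⟩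
        refine ⟨a + c, c * l + d + b, fun z ↦ ?_⟩
        rw [← add_assoc, h', h, ← mul_assoc, ← Complex.exp_add]
        congr 2
        ring
      neg_mem' := by
        rintro l ⟨a, b, h⟩
        refine ⟨-a, a * l - b, fun z ↦ ?_⟩
        have := h (z + -l)
        rw [neg_add_cancel_right] at this
        rw [this, ← mul_assoc, ← Complex.exp_add, show -a * z + (a * l - b) + (a * (z + -l) + b) = 0
          by ring, Complex.exp_zero, one_mul] }
  obtain ⟨m, n, rfl⟩ := (mem_upperPeriodPair_lattice hτ).mp hl
  have h1 : (1 : ℂ) ∈ S := ⟨_, _, oddTheta_add_one τ⟩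
  have h2 : τ ∈ S := ⟨_, _, oddTheta_add_self τ⟩
  have h3 := S.add_mem (S.zsmul_mem h1 m) (S.zsmul_mem h2 n)
  simp only [zsmul_eq_mul] at h3
  exact h3

theorem weierstrassP_sub_eq_oddTheta {z v : ℂ} (hz : z ∉ (upperPeriodPair τ hτ).lattice)
    (hv : v ∉ (upperPeriodPair τ hτ).lattice) :
    ℘[upperPeriodPair τ hτ] z - ℘[upperPeriodPair τ hτ] v =
      -(deriv (oddTheta τ) 0 ^ 2 * (oddTheta τ (z + v) * oddTheta τ (z - v)) /
        (oddTheta τ z ^ 2 * oddTheta τ v ^ 2)) :=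
  (upperPeriodPair τ hτ).weierstrassP_sub (differentiable_oddTheta hτ) (oddTheta_neg τ)
    (deriv_oddTheta_zero_ne_zero hτ)
    (fun _ h ↦ (mem_upperPeriodPair_lattice hτ).mpr (exists_int_of_oddTheta_eq_zero hτ h))
    (fun _ hl ↦ exists_oddTheta_add_eq hτ hl) hz hv

theorem derivWeierstrassP_eq_oddTheta {v : ℂ} (hv : v ∉ (upperPeriodPair τ hτ).lattice) :
    ℘'[upperPeriodPair τ hτ] v =
      -(deriv (oddTheta τ) 0 ^ 3 * oddTheta τ (2 * v) / oddTheta τ v ^ 4) :=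
  (upperPeriodPair τ hτ).derivWeierstrassP_eq (differentiable_oddTheta hτ) (oddTheta_neg τ)
    (deriv_oddTheta_zero_ne_zero hτ)
    (fun _ h ↦ (mem_upperPeriodPair_lattice hτ).mpr (exists_int_of_oddTheta_eq_zero hτ h))
    (fun _ hl ↦ exists_oddTheta_add_eq hτ hl) hv

end PeriodPair

/-! ### Lattice sums of inverse powers as polynomials in `℘`. -/

namespace PeriodPair

variable (L : PeriodPair)

theorem sumInvPow_neg (x : ℂ) {k : ℕ} (hk : Even k) : L.sumInvPow (-x) k = L.sumInvPow x k := by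
  rw [sumInvPow, sumInvPow, ← (Equiv.neg _).tsum_eq]
  refine tsum_congr fun l ↦ ?_
  rw [← hk.neg_pow]
  simp
  ring

theorem sumInvPow_sub_mem (x : ℂ) {w : ℂ} (hw : w ∈ L.lattice) (k : ℕ) :
    L.sumInvPow (x - w) k = L.sumInvPow x k := by
  rw [sumInvPow, sumInvPow, ← (Equiv.subRight (⟨w, hw⟩ : L.lattice)).tsum_eq]
  refine tsum_congr fun l ↦ ?_
  simp

variable {x : ℂ} (hx : x ∉ L.lattice) (hx' : ℘'[L] x ≠ 0)

theorem hasDerivAt_weierstrassP {x : ℂ} (hx : x ∉ L.lattice) :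
    HasDerivAt ℘[L] (℘'[L] x) x := by
  rw [← L.deriv_weierstrassP]
  exact (L.analyticOnNhd_weierstrassP x hx).differentiableAt.hasDerivAt

-- Differentiate `℘'² = 4℘³ - g₂℘ - g₃` and cancel `2℘'`, whence the assumption `℘' x ≠ 0`.
include hx hx' in
theorem deriv_derivWeierstrassP : deriv ℘'[L] x = 6 * ℘[L] x ^ 2 - L.g₂ / 2 := by
  have h1 := (L.analyticOnNhd_derivWeierstrassP x hx).differentiableAt.hasDerivAt
  have h2 := L.hasDerivAt_weierstrassP hx
  have h3 : (fun z ↦ ℘'[L] z ^ 2) =ᶠ[𝓝 x] fun z ↦ 4 * ℘[L] z ^ 3 - L.g₂ * ℘[L] z - L.g₃ := by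
    filter_upwards [L.isClosed_lattice.isOpen_compl.mem_nhds hx] with z hz
    exact L.derivWeierstrassP_sq z hz
  have h4 := h3.deriv_eq
  rw [(h1.fun_pow 2).deriv,
    ((((h2.fun_pow 3).const_mul 4).fun_sub (h2.const_mul L.g₂)).sub_const L.g₃).deriv] at h4
  refine mul_left_cancel₀ hx' ?_
  push_cast at h4
  linear_combination h4 / 2

include hx hx' in
theorem sumInvPow_four : 6 * L.sumInvPow x 4 = 6 * ℘[L] x ^ 2 - L.g₂ / 2 := by
  rw [← L.deriv_derivWeierstrassP hx hx', ← L.deriv_derivWeierstrassPExcept_self x,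
    L.derivWeierstrassPExcept_of_notMem x hx]

-- Both sides are the fourth derivative of `℘`: termwise it is `5! ∑ (l - x)^{-6}`, and from `℘''' =
-- 12 ℘ ℘'` it is `12 (℘'² + ℘ ℘'')`.
include hx hx' in
theorem sumInvPow_six :
    120 * L.sumInvPow x 6 = 120 * ℘[L] x ^ 3 - 18 * L.g₂ * ℘[L] x - 12 * L.g₃ := by
  have h0 := L.iteratedDeriv_derivWeierstrassPExcept_self x (n := 3)
  rw [L.derivWeierstrassPExcept_of_notMem x hx] at h0
  have hev0 : ∀ᶠ z in 𝓝 x, z ∉ L.lattice := L.isClosed_lattice.isOpen_compl.mem_nhds hx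
  have hev : ∀ᶠ z in 𝓝 x, z ∉ L.lattice ∧ ℘'[L] z ≠ 0 :=
    hev0.and ((L.analyticOnNhd_derivWeierstrassP x hx).continuousAt.eventually_ne hx')
  have h2 : deriv ℘'[L] =ᶠ[𝓝 x] fun z ↦ 6 * ℘[L] z ^ 2 - L.g₂ / 2 := by
    filter_upwards [hev] with z hz using L.deriv_derivWeierstrassP hz.1 hz.2
  have h3 : deriv (deriv ℘'[L]) =ᶠ[𝓝 x] fun z ↦ 12 * (℘[L] z * ℘'[L] z) := by
    filter_upwards [h2.eventuallyEq_nhds, hev] with z hz hz'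
    rw [hz.deriv_eq,
      ((((L.hasDerivAt_weierstrassP hz'.1).fun_pow 2).const_mul 6).sub_const _).deriv]
    push_cast
    ring
  have h4 : iteratedDeriv 3 ℘'[L] x = 12 * (℘'[L] x * ℘'[L] x + ℘[L] x * deriv ℘'[L] x) := by
    rw [iteratedDeriv_succ, iteratedDeriv_succ, iteratedDeriv_one, h3.deriv_eq]
    exact (((L.hasDerivAt_weierstrassP hx).fun_mul
      (L.analyticOnNhd_derivWeierstrassP x hx).differentiableAt.hasDerivAt).const_mul 12).deriv
  rw [h4, L.deriv_derivWeierstrassP hx hx'] at h0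
  have h5 := L.derivWeierstrassP_sq x hx
  norm_num [Nat.factorial] at h0
  linear_combination -h0 + 12 * h5

end PeriodPair

/-! ### Splitting a lattice sum over cosets of an index-`N` sublattice. -/

section Isogeny

variable {τ : ℂ} (hτ : 0 < τ.im)

theorem sumInvPow_upperPeriodPair (x : ℂ) (k : ℕ) :
    (upperPeriodPair τ hτ).sumInvPow x k = ∑' p : ℤ × ℤ, ((p.1 + p.2 * τ - x) ^ k)⁻¹ := by
  rw [PeriodPair.sumInvPow, ← (upperPeriodPair τ hτ).latticeEquivProd.symm.toEquiv.tsum_eq]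
  refine tsum_congr fun p ↦ ?_
  congr 3
  exact ((upperPeriodPair τ hτ).latticeEquiv_symm_apply p).trans (by simp [upperPeriodPair])

include hτ in
theorem summable_inv_pow {k : ℕ} (hk : 2 < k) :
    Summable fun p : ℤ × ℤ ↦ (((p.1 : ℂ) + p.2 * τ) ^ k)⁻¹ := by
  have h := ((upperPeriodPair τ hτ).hasSum_sumInvPow 0 hk).summable
  rw [← (upperPeriodPair τ hτ).latticeEquivProd.symm.toEquiv.summable_iff] at h
  refine h.congr fun p ↦ ?_
  have : ((upperPeriodPair τ hτ).latticeEquivProd.symm p : ℂ) = p.1 + p.2 * τ :=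
    ((upperPeriodPair τ hτ).latticeEquiv_symm_apply p).trans (by simp [upperPeriodPair])
  simp [this]

/-- Divide the coefficient of `τ` by `N`; the remainder `j` labels the coset. Absolute convergence
for `k > 2` permits the regrouping. -/
theorem G_upperPeriodPair_eq_sum (N : ℕ) [NeZero N] (hN : 0 < (N * τ).im) {k : ℕ} (hk : 2 < k) :
    (upperPeriodPair τ hτ).G k =
      ∑ j : Fin N, (upperPeriodPair (N * τ) hN).sumInvPow (-(j * τ)) k := by
  let e : Fin N × (ℤ × ℤ) ≃ ℤ × ℤ := (Equiv.prodComm _ _).trans ((Equiv.prodAssoc _ _ _).trans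
    (Equiv.prodCongr (Equiv.refl ℤ) (Int.divModEquiv N).symm))
  have hs := e.summable_iff.mpr (summable_inv_pow hτ hk)
  rw [← PeriodPair.sumInvPow_zero, sumInvPow_upperPeriodPair]
  simp_rw [sub_zero]
  rw [← e.tsum_eq]
  refine hs.tsum_prod.trans ?_
  rw [tsum_fintype]
  refine Finset.sum_congr rfl fun j _ ↦ ?_
  rw [sumInvPow_upperPeriodPair]
  refine tsum_congr fun p ↦ ?_
  have he : e (j, p) = (p.1, p.2 * N + (j : ℕ)) := rfl
  rw [Function.comp_apply, he]
  push_cast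
  congr 2
  ring

/-- For even `k` the cosets of `jτ` and `(7 - j)τ = -jτ + 7τ` contribute equally. -/
theorem G_upperPeriodPair_seven (h7 : 0 < ((7 : ℕ) * τ).im) {k : ℕ} (hk : 2 < k) (he : Even k) :
    (upperPeriodPair τ hτ).G k = (upperPeriodPair ((7 : ℕ) * τ) h7).G k +
      2 * ((upperPeriodPair ((7 : ℕ) * τ) h7).sumInvPow (1 * τ) k +
        (upperPeriodPair ((7 : ℕ) * τ) h7).sumInvPow (2 * τ) k +
        (upperPeriodPair ((7 : ℕ) * τ) h7).sumInvPow (3 * τ) k) := by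
  have hmem : (7 * τ) ∈ (upperPeriodPair ((7 : ℕ) * τ) h7).lattice :=
    (mem_upperPeriodPair_lattice h7).mpr ⟨0, 1, by simp⟩
  have hrefl (a b : ℂ) (hab : a + b = 7) :
      (upperPeriodPair ((7 : ℕ) * τ) h7).sumInvPow (a * τ) k =
      (upperPeriodPair ((7 : ℕ) * τ) h7).sumInvPow (b * τ) k := by
    rw [← PeriodPair.sumInvPow_sub_mem _ (a * τ) hmem, ← PeriodPair.sumInvPow_neg _ _ he]
    congr 1
    linear_combination -τ * hab
  rw [G_upperPeriodPair_eq_sum hτ 7 h7 hk, Fin.sum_univ_seven]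
  simp_rw [PeriodPair.sumInvPow_neg _ _ he]
  have e4 := hrefl 4 3 (by norm_num)
  have e5 := hrefl 5 2 (by norm_num)
  have e6 := hrefl 6 1 (by norm_num)
  simp only [Fin.val_zero, Fin.val_one, Fin.val_two, Nat.cast_zero, zero_mul, Nat.cast_one,
    PeriodPair.sumInvPow_zero]
  have v3 : ((3 : Fin 7) : ℕ) = 3 := rfl
  have v4 : ((4 : Fin 7) : ℕ) = 4 := rfl
  have v5 : ((5 : Fin 7) : ℕ) = 5 := rfl
  have v6 : ((6 : Fin 7) : ℕ) = 6 := rfl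
  simp only [v3, v4, v5, v6, Nat.cast_ofNat] at *
  rw [e4, e5, e6]
  ring

end Isogeny

/-! ### The invariants `g₂`, `g₃` as Eisenstein series. -/

section Eisenstein

variable {τ : ℂ} (hτ : 0 < τ.im) {q : ℂ} (hq : q = cexp (2 * π * I * τ))

include hq in
theorem G_upperPeriodPair {k : ℕ} (hk : 3 ≤ k) (he : Even k) :
    (upperPeriodPair τ hτ).G k = 2 * riemannZeta k + 2 * ((-2 * π * I) ^ k / (k - 1).factorial) *
      ∑' n : ℕ+, (n : ℂ) ^ (k - 1) * q ^ (n : ℕ) / (1 - q ^ (n : ℕ)) := by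
  have h1 := tsum_eisSummand_eq_tsum_sigma_mul_cexp_pow hk he ⟨τ, hτ⟩
  rw [tsum_pow_div_one_sub_eq_tsum_sigma (hq ▸ norm_exp_two_pi_I_mul_lt_one hτ), hq]
  refine Eq.trans ?_ h1
  rw [← PeriodPair.sumInvPow_zero, sumInvPow_upperPeriodPair, ← (finTwoArrowEquiv ℤ).symm.tsum_eq,
    ← (Equiv.prodComm ℤ ℤ).tsum_eq]
  refine tsum_congr fun p ↦ ?_
  simp [EisensteinSeries.eisSummand, add_comm]

theorem bernoulli_six : bernoulli 6 = 1 / 42 := by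
  rw [bernoulli_eq_bernoulli'_of_ne_one (by norm_num), bernoulli'_def]
  norm_num [Finset.sum_range_succ, Nat.choose, bernoulli'_eq_zero_of_odd]

include hq in
theorem g₂_upperPeriodPair :
    (upperPeriodPair τ hτ).g₂ = (2 * π * I) ^ 4 / 12 * Septic.eisenstein 2 q := by
  have h1 := riemannZeta_neg_nat_eq_bernoulli 3
  have h2 : bernoulli 4 = -1 / 30 := by
    rw [bernoulli_eq_bernoulli'_of_ne_one (by norm_num), bernoulli'_four]
  have h3 : riemannZeta (1 - 2 * (2 : ℕ)) = 1 / 120 := by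
    rw [show (1 - 2 * (2 : ℕ) : ℂ) = -(3 : ℕ) by norm_num, h1, h2]
    norm_num
  have hI : I ^ 4 = 1 := Complex.I_pow_four
  rw [PeriodPair.g₂, G_upperPeriodPair hτ hq (by norm_num) (by decide), Septic.eisenstein, h3,
    Nat.cast_ofNat, riemannZeta_four, mul_pow, mul_pow, mul_pow, mul_pow, hI]
  norm_num [Nat.factorial]
  ring

include hq in
theorem g₃_upperPeriodPair :
    (upperPeriodPair τ hτ).g₃ = -((2 * π * I) ^ 6 / 216) * Septic.eisenstein 3 q := by
  have h1 := riemannZeta_neg_nat_eq_bernoulli 5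
  have h3 : riemannZeta (1 - 2 * (3 : ℕ)) = -1 / 252 := by
    rw [show (1 - 2 * (3 : ℕ) : ℂ) = -(5 : ℕ) by norm_num, h1, bernoulli_six]
    norm_num
  have h4 : riemannZeta ((6 : ℕ) : ℂ) = π ^ 6 / 945 := by
    rw [show ((6 : ℕ) : ℂ) = 2 * (3 : ℕ) by norm_num, riemannZeta_two_mul_nat (by norm_num),
      show 2 * 3 = 6 by norm_num, bernoulli_six]
    norm_num [Nat.factorial]
    ring
  have hI : I ^ 6 = -1 := by rw [show 6 = 4 + 2 by norm_num, pow_add, Complex.I_pow_four]; simp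
  rw [PeriodPair.g₃, G_upperPeriodPair hτ hq (by norm_num) (by decide), Septic.eisenstein, h3,
    h4, mul_pow, mul_pow, mul_pow, mul_pow, hI]
  norm_num [Nat.factorial]
  ring

end Eisenstein

/-! ### Theta, `℘` and `℘'` at the 7-torsion points `jτ`. -/

section Values

variable (τ : UpperHalfPlane)

theorem qpow_eq_pow (r : ℝ) (n : ℕ) : Septic.qpow τ (r * n) = Septic.qpow τ r ^ n := by
  rw [Septic.qpow, Septic.qpow, ← Complex.exp_nat_mul]
  congr 1
  push_cast
  ring

theorem qpow_ne_zero (r : ℝ) : Septic.qpow τ r ≠ 0 := Complex.exp_ne_zero _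

/-- The theta series `∑ (-1)^n q^{(14 n + r)^2 / 56}`. -/
noncomputable def septicTheta (r : ℤ) : ℂ :=
  ∑' n : ℤ, (-1 : ℂ) ^ n * Septic.qpow τ ((14 * (n : ℝ) + r) ^ 2 / 56)

theorem septicTheta_add (r : ℤ) : septicTheta τ (r + 14) = -septicTheta τ r := by
  rw [septicTheta, septicTheta, ← tsum_neg, ← (Equiv.addRight (1 : ℤ)).tsum_eq fun n ↦ -(_ * _)]
  refine tsum_congr fun n ↦ ?_
  rw [Equiv.coe_addRight, zpow_add_one₀ (by norm_num)]
  push_cast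
  rw [show (14 * (n : ℝ) + (r + 14)) = 14 * (n + 1) + r by ring]
  ring

theorem septicTheta_neg (r : ℤ) : septicTheta τ (-r) = septicTheta τ r := by
  rw [septicTheta, septicTheta, ← (Equiv.neg ℤ).tsum_eq]
  refine tsum_congr fun n ↦ ?_
  rw [Equiv.neg_apply, zpow_neg, ← inv_zpow, inv_neg, inv_one]
  push_cast
  rw [show (14 * -(n : ℝ) + -r) ^ 2 = (14 * n + r) ^ 2 by ring]

theorem thetaA_eq : Septic.thetaA τ = -septicTheta τ 5 := by
  simp [Septic.thetaA, septicTheta]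

theorem thetaB_eq : Septic.thetaB τ = septicTheta τ 3 := by
  simp [Septic.thetaB, septicTheta]

theorem thetaC_eq : Septic.thetaC τ = septicTheta τ 1 := by
  simp [Septic.thetaC, septicTheta]

/-- Completing the square: `7(n + 1/2)²/2 + (n + 1/2)j = (14n + 7 + 2j)²/56 - j²/14`. -/
theorem oddTheta_mul_eq_septicTheta (j : ℕ) :
    oddTheta ((7 : ℕ) * τ) (j * τ) * Septic.qpow τ (1 / 14) ^ (j ^ 2) =
      -septicTheta τ (7 + 2 * j) := by
  rw [← qpow_eq_pow, oddTheta, jacobiTheta₂, septicTheta, ← tsum_mul_left, ← tsum_mul_right,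
    ← tsum_neg]
  refine tsum_congr fun n ↦ ?_
  rw [← Complex.exp_pi_mul_I, ← Complex.exp_int_mul, Septic.qpow, Septic.qpow, jacobiTheta₂_term,
    neg_mul, neg_mul, ← Complex.exp_add, ← Complex.exp_add, ← Complex.exp_add]
  congr 2
  push_cast
  ring

theorem seven_mul_im_pos : 0 < (((7 : ℕ) : ℂ) * τ).im := by
  simpa using τ.im_pos

theorem natCast_mul_notMem_lattice {j : ℕ} (h : ¬ 7 ∣ j) :
    (j * τ : ℂ) ∉ (upperPeriodPair ((7 : ℕ) * τ) (seven_mul_im_pos τ)).lattice := by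
  rw [mem_upperPeriodPair_lattice]
  rintro ⟨m, n, hmn⟩
  have h1 := congrArg Complex.im hmn
  simp at h1
  have h2 : (n : ℝ) * 7 = j := mul_right_cancel₀ τ.im_pos.ne' (by linear_combination h1)
  have h3 : n * 7 = j := by exact_mod_cast h2
  omega

theorem oddTheta_natCast_mul_ne_zero {j : ℕ} (h : ¬ 7 ∣ j) :
    oddTheta ((7 : ℕ) * τ) (j * τ) ≠ 0 := fun h0 ↦
  natCast_mul_notMem_lattice τ h ((mem_upperPeriodPair_lattice _).mpr
    (exists_int_of_oddTheta_eq_zero (seven_mul_im_pos τ) h0))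

theorem deriv_oddTheta_eq_factor :
    deriv (oddTheta ((7 : ℕ) * τ)) 0 = -(2 * π * I) * Septic.factor τ := by
  have hq : Septic.qpow τ 1 ^ 7 = cexp (2 * π * I * ((7 : ℕ) * τ)) := by
    rw [Septic.qpow, ← Complex.exp_nat_mul]
    congr 1
    push_cast
    ring
  rw [deriv_oddTheta_zero (seven_mul_im_pos τ) hq, Septic.factor, Septic.qPochInf, Septic.qpow]
  congr 3
  push_cast
  ring

/-- The values of the odd theta function of modulus `7 τ` at multiples of `τ`. -/
theorem oddTheta_values :
    oddTheta ((7 : ℕ) * τ) (1 * τ) = -Septic.thetaA τ / Septic.qpow τ (1 / 14) ∧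
    oddTheta ((7 : ℕ) * τ) (2 * τ) = Septic.thetaB τ / Septic.qpow τ (1 / 14) ^ 4 ∧
    oddTheta ((7 : ℕ) * τ) (3 * τ) = Septic.thetaC τ / Septic.qpow τ (1 / 14) ^ 9 ∧
    oddTheta ((7 : ℕ) * τ) (4 * τ) = Septic.thetaC τ / Septic.qpow τ (1 / 14) ^ 16 ∧
    oddTheta ((7 : ℕ) * τ) (5 * τ) = Septic.thetaB τ / Septic.qpow τ (1 / 14) ^ 25 ∧
    oddTheta ((7 : ℕ) * τ) (6 * τ) = -Septic.thetaA τ / Septic.qpow τ (1 / 14) ^ 36 := by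
  have he := qpow_ne_zero τ (1 / 14)
  have h1 := oddTheta_mul_eq_septicTheta τ 1
  have h2 := oddTheta_mul_eq_septicTheta τ 2
  have h3 := oddTheta_mul_eq_septicTheta τ 3
  have h4 := oddTheta_mul_eq_septicTheta τ 4
  have h5 := oddTheta_mul_eq_septicTheta τ 5
  have h6 := oddTheta_mul_eq_septicTheta τ 6
  rw [show (7 + 2 * (1 : ℕ) : ℤ) = -5 + 14 by norm_num, septicTheta_add, septicTheta_neg] at h1
  rw [show (7 + 2 * (2 : ℕ) : ℤ) = -3 + 14 by norm_num, septicTheta_add, septicTheta_neg] at h2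
  rw [show (7 + 2 * (3 : ℕ) : ℤ) = -1 + 14 by norm_num, septicTheta_add, septicTheta_neg] at h3
  rw [show (7 + 2 * (4 : ℕ) : ℤ) = 1 + 14 by norm_num, septicTheta_add] at h4
  rw [show (7 + 2 * (5 : ℕ) : ℤ) = 3 + 14 by norm_num, septicTheta_add] at h5
  rw [show (7 + 2 * (6 : ℕ) : ℤ) = 5 + 14 by norm_num, septicTheta_add] at h6
  simp only [neg_neg, Nat.cast_ofNat, Nat.cast_one] at *
  rw [thetaA_eq, thetaB_eq, thetaC_eq, neg_neg]
  refine ⟨?_, ?_, ?_, ?_, ?_, ?_⟩ <;> rw [eq_div_iff (by positivity)]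
  exacts [by simpa using h1, by simpa using h2, by simpa using h3, by simpa using h4,
    by simpa using h5, by simpa using h6]

theorem theta_ne_zero :
    Septic.thetaA τ ≠ 0 ∧ Septic.thetaB τ ≠ 0 ∧ Septic.thetaC τ ≠ 0 := by
  obtain ⟨h1, h2, h3, -⟩ := oddTheta_values τ
  have n1 := oddTheta_natCast_mul_ne_zero τ (j := 1) (by norm_num)
  have n2 := oddTheta_natCast_mul_ne_zero τ (j := 2) (by norm_num)
  have n3 := oddTheta_natCast_mul_ne_zero τ (j := 3) (by norm_num)
  simp only [Nat.cast_one, Nat.cast_ofNat (n := 2), Nat.cast_ofNat (n := 3)] at n1 n2 n3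
  rw [h1] at n1
  rw [h2] at n2
  rw [h3] at n3
  exact ⟨fun h ↦ n1 (by simp [h]), fun h ↦ n2 (by simp [h]), fun h ↦ n3 (by simp [h])⟩

theorem factor_ne_zero : Septic.factor τ ≠ 0 := by
  have h := deriv_oddTheta_zero_ne_zero (seven_mul_im_pos τ)
  rw [deriv_oddTheta_eq_factor] at h
  exact right_ne_zero_of_mul h

theorem param_ne_zero :
    Septic.paramX τ ≠ 0 ∧ Septic.paramY τ ≠ 0 ∧ Septic.paramZ τ ≠ 0 := by
  obtain ⟨ha, hb, hc⟩ := theta_ne_zero τ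
  have hF := factor_ne_zero τ
  refine ⟨?_, ?_, ?_⟩ <;> simp [Septic.paramX, Septic.paramY, Septic.paramZ, *]

/-- The lattice `ℤ + 7 τ ℤ`. -/
noncomputable def septicPair : PeriodPair := upperPeriodPair ((7 : ℕ) * τ) (seven_mul_im_pos τ)

/-- The powers of `q^{1/14}` cancel because `(j + k)² + (j - k)² = 2j² + 2k²`. -/
theorem weierstrassP_differences :
    ℘[septicPair τ] (1 * τ) - ℘[septicPair τ] (2 * τ) =
      (2 * π * I) ^ 2 * (Septic.paramY τ * Septic.paramZ τ) ∧
    ℘[septicPair τ] (1 * τ) - ℘[septicPair τ] (3 * τ) =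
      (2 * π * I) ^ 2 * (Septic.paramX τ * Septic.paramZ τ) ∧
    ℘[septicPair τ] (2 * τ) - ℘[septicPair τ] (3 * τ) =
      (2 * π * I) ^ 2 * (Septic.paramX τ * Septic.paramY τ) := by
  have n1 := natCast_mul_notMem_lattice τ (j := 1) (by norm_num)
  have n2 := natCast_mul_notMem_lattice τ (j := 2) (by norm_num)
  have n3 := natCast_mul_notMem_lattice τ (j := 3) (by norm_num)
  have he := qpow_ne_zero τ (1 / 14)
  obtain ⟨ha, hb, hc⟩ := theta_ne_zero τ
  obtain ⟨h1, h2, h3, h4, h5, h6⟩ := oddTheta_values τ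
  have k12 := weierstrassP_sub_eq_oddTheta _ n1 n2
  have k13 := weierstrassP_sub_eq_oddTheta _ n1 n3
  have k23 := weierstrassP_sub_eq_oddTheta _ n2 n3
  simp only [Nat.cast_one, Nat.cast_ofNat (n := 2), Nat.cast_ofNat (n := 3)] at k12 k13 k23
  rw [show (1 : ℂ) * τ + 2 * τ = 3 * τ by ring, show (1 : ℂ) * τ - 2 * τ = -(1 * τ) by ring,
    oddTheta_neg, deriv_oddTheta_eq_factor, h1, h2, h3] at k12
  rw [show (1 : ℂ) * τ + 3 * τ = 4 * τ by ring, show (1 : ℂ) * τ - 3 * τ = -(2 * τ) by ring,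
    oddTheta_neg, deriv_oddTheta_eq_factor, h1, h2, h3, h4] at k13
  rw [show (2 : ℂ) * τ + 3 * τ = 5 * τ by ring, show (2 : ℂ) * τ - 3 * τ = -(1 * τ) by ring,
    oddTheta_neg, deriv_oddTheta_eq_factor, h1, h2, h3, h5] at k23
  refine ⟨k12.trans ?_, k13.trans ?_, k23.trans ?_⟩ <;>
    simp only [Septic.paramX, Septic.paramY, Septic.paramZ] <;> field_simp

theorem derivWeierstrassP_values :
    ℘'[septicPair τ] (1 * τ) = (2 * π * I) ^ 3 * (Septic.paramZ τ ^ 2 * Septic.paramX τ) ∧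
    ℘'[septicPair τ] (2 * τ) = (2 * π * I) ^ 3 * (Septic.paramY τ ^ 2 * Septic.paramZ τ) ∧
    ℘'[septicPair τ] (3 * τ) = (2 * π * I) ^ 3 * (Septic.paramX τ ^ 2 * Septic.paramY τ) := by
  have n1 := natCast_mul_notMem_lattice τ (j := 1) (by norm_num)
  have n2 := natCast_mul_notMem_lattice τ (j := 2) (by norm_num)
  have n3 := natCast_mul_notMem_lattice τ (j := 3) (by norm_num)
  have he := qpow_ne_zero τ (1 / 14)
  obtain ⟨ha, hb, hc⟩ := theta_ne_zero τ
  obtain ⟨h1, h2, h3, h4, h5, h6⟩ := oddTheta_values τ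
  have k1 := derivWeierstrassP_eq_oddTheta _ n1
  have k2 := derivWeierstrassP_eq_oddTheta _ n2
  have k3 := derivWeierstrassP_eq_oddTheta _ n3
  simp only [Nat.cast_one, Nat.cast_ofNat (n := 2), Nat.cast_ofNat (n := 3)] at k1 k2 k3
  rw [show (2 : ℂ) * (1 * τ) = 2 * τ by ring, deriv_oddTheta_eq_factor, h1, h2] at k1
  rw [show (2 : ℂ) * (2 * τ) = 4 * τ by ring, deriv_oddTheta_eq_factor, h2, h4] at k2
  rw [show (2 : ℂ) * (3 * τ) = 6 * τ by ring, deriv_oddTheta_eq_factor, h3, h6] at k3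
  refine ⟨k1.trans ?_, k2.trans ?_, k3.trans ?_⟩ <;>
    simp only [Septic.paramX, Septic.paramY, Septic.paramZ] <;> field_simp

end Values

/-! ### Elimination and the final identities. -/

/-- The coordinates of multiples of a 7-torsion point determine the curve and its quotient. -/
theorem septic_elimination {x y z p₁ p₂ p₃ e f e' f' : ℂ} (hx : x ≠ 0) (hy : y ≠ 0) (hz : z ≠ 0)
    (h12 : p₁ - p₂ = y * z) (h13 : p₁ - p₃ = x * z) (h23 : p₂ - p₃ = x * y)
    (h1 : (z ^ 2 * x) ^ 2 = 4 * p₁ ^ 3 - e / 12 * p₁ + f / 216)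
    (h2 : (y ^ 2 * z) ^ 2 = 4 * p₂ ^ 3 - e / 12 * p₂ + f / 216)
    (h3 : (x ^ 2 * y) ^ 2 = 4 * p₃ ^ 3 - e / 12 * p₃ + f / 216)
    (he' : e' = -29 * e + 1440 * (p₁ ^ 2 + p₂ ^ 2 + p₃ ^ 2))
    (hf' : f' = -83 * f - 60480 * (p₁ ^ 3 + p₂ ^ 3 + p₃ ^ 3) + 756 * e * (p₁ + p₂ + p₃)) :
    e' =
      x ^ 4 - 116 * x ^ 3 * y + 116 * x * y ^ 3 + y ^ 4 - 116 * x ^ 3 * z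
        + 848 * x * y * z ^ 2 + 848 * x ^ 2 * y * z - 848 * x * y ^ 2 * z
        - 116 * y ^ 3 * z + 116 * x * z ^ 3 + 116 * y * z ^ 3 + z ^ 4 ∧
    e =
      x ^ 4 + 4 * x ^ 3 * y - 4 * x * y ^ 3 + y ^ 4 + 4 * x ^ 3 * z
        + 8 * x * y * z ^ 2 + 8 * x ^ 2 * y * z - 8 * x * y ^ 2 * z
        + 4 * y ^ 3 * z - 4 * x * z ^ 3 - 4 * y * z ^ 3 + z ^ 4 ∧
    f' =
      x ^ 6 + 258 * x ^ 5 * y - 5904 * x ^ 4 * y ^ 2 - 5904 * x ^ 2 * y ^ 4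
        - 258 * x * y ^ 5 + y ^ 6 + 258 * x ^ 5 * z + 7310 * x ^ 3 * y ^ 2 * z
        + 7310 * x ^ 2 * y ^ 3 * z + 258 * y ^ 5 * z - 5904 * x ^ 4 * z ^ 2
        + 7310 * x ^ 3 * y * z ^ 2 - 8751 * x ^ 2 * y ^ 2 * z ^ 2
        - 7310 * x * y ^ 3 * z ^ 2 - 5904 * y ^ 4 * z ^ 2 - 7310 * x ^ 2 * y * z ^ 3
        - 7310 * x * y ^ 2 * z ^ 3 - 5904 * x ^ 2 * z ^ 4 - 5904 * y ^ 2 * z ^ 4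
        - 258 * x * z ^ 5 - 258 * y * z ^ 5 + z ^ 6 ∧
    f =
      x ^ 6 + 6 * x ^ 5 * y + 18 * x ^ 4 * y ^ 2 + 18 * x ^ 2 * y ^ 4
        - 6 * x * y ^ 5 + y ^ 6 + 6 * x ^ 5 * z + 2 * x ^ 3 * y ^ 2 * z
        + 2 * x ^ 2 * y ^ 3 * z + 6 * y ^ 5 * z + 18 * x ^ 4 * z ^ 2
        + 2 * x ^ 3 * y * z ^ 2 - 57 * x ^ 2 * y ^ 2 * z ^ 2 - 2 * x * y ^ 3 * z ^ 2
        + 18 * y ^ 4 * z ^ 2 - 2 * x ^ 2 * y * z ^ 3 - 2 * x * y ^ 2 * z ^ 3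
        + 18 * x ^ 2 * z ^ 4 + 18 * y ^ 2 * z ^ 4 - 6 * x * z ^ 5
        - 6 * y * z ^ 5 + z ^ 6 := by
  -- The three differences force `xz = y(x + z)`, a rational cone, parametrized here by `t = x/z`
  -- and `s = z/(t + 1)`.
  obtain ⟨s, t, hs, ht, ht1, rfl, rfl, rfl⟩ : ∃ s t : ℂ, s ≠ 0 ∧ t ≠ 0 ∧ t + 1 ≠ 0 ∧
      x = s * t * (t + 1) ∧ y = s * t ∧ z = s * (t + 1) := by
    have hxyz : x * z = y * (x + z) := by linear_combination h23 + h12 - h13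
    have hxz : x + z ≠ 0 := fun h ↦ mul_ne_zero hx hz (by rw [hxyz, h, mul_zero])
    have ht1 : x / z + 1 ≠ 0 := by rw [div_add_one hz]; exact div_ne_zero hxz hz
    have hy' : y = x * z / (x + z) := by rw [hxyz]; field_simp
    refine ⟨z / (x / z + 1), x / z, div_ne_zero hz ht1, div_ne_zero hx hz, ht1, ?_, ?_, ?_⟩
    · field_simp
    · rw [hy']; field_simp
    · field_simp
  obtain rfl : p₂ = p₁ - s * t * (s * (t + 1)) := by linear_combination -h12
  obtain rfl : p₃ = p₁ - s * t * (t + 1) * (s * (t + 1)) := by linear_combination -h13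
  have k1 : e / 12 = 4 * (p₁ ^ 2 + p₁ * (p₁ - s * t * (s * (t + 1))) +
      (p₁ - s * t * (s * (t + 1))) ^ 2) - s ^ 4 * t * (t + 1) * ((t + 1) ^ 4 - t ^ 2) :=
    mul_left_cancel₀ (mul_ne_zero hy hz) (by linear_combination h1 - h2)
  have k2 : e / 12 = 4 * (p₁ ^ 2 + p₁ * (p₁ - s * t * (t + 1) * (s * (t + 1))) +
      (p₁ - s * t * (t + 1) * (s * (t + 1))) ^ 2) -
        s ^ 4 * t * (t + 1) ^ 2 * ((t + 1) ^ 2 - t ^ 4) :=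
    mul_left_cancel₀ (mul_ne_zero hx hz) (by linear_combination h1 - h3)
  -- In `k2 - k1` both `e` and the quadratic terms in `p₁` drop out, since the difference of the two
  -- brackets is `(p₃ - p₂)(p₁ + p₂ + p₃)`.
  have k3 : p₁ = (s ^ 2 * (t ^ 2 + t + 1) ^ 2 / 4 + s ^ 2 * t * (t + 1) * (t + 2)) / 3 := by
    refine mul_left_cancel₀ (mul_ne_zero (by norm_num : (12 : ℂ) ≠ 0) (mul_ne_zero hx hy)) ?_
    linear_combination k2 - k1
  have k4 : f / 216 = (s ^ 2 * (t + 1) ^ 2 * (s * t * (t + 1))) ^ 2 - 4 * p₁ ^ 3 + e / 12 * p₁ := by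
    linear_combination -h1
  have k5 := k1
  subst k3
  obtain rfl := (div_eq_iff (by norm_num)).mp k5
  obtain rfl := (div_eq_iff (by norm_num)).mp k4
  subst he' hf'
  refine ⟨?_, ?_, ?_, ?_⟩ <;> ring

theorem theorem4p6 (τ : UpperHalfPlane) (q x y z : ℂ)
    (hq : q = Complex.exp (2 * Real.pi * Complex.I * τ))
    (hx : x = Septic.paramX τ) (hy : y = Septic.paramY τ) (hz : z = Septic.paramZ τ) :
    Septic.eisenstein 2 q =
      x ^ 4 - 116 * x ^ 3 * y + 116 * x * y ^ 3 + y ^ 4 - 116 * x ^ 3 * z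
        + 848 * x * y * z ^ 2 + 848 * x ^ 2 * y * z - 848 * x * y ^ 2 * z
        - 116 * y ^ 3 * z + 116 * x * z ^ 3 + 116 * y * z ^ 3 + z ^ 4 ∧
    Septic.eisenstein 2 (q ^ 7) =
      x ^ 4 + 4 * x ^ 3 * y - 4 * x * y ^ 3 + y ^ 4 + 4 * x ^ 3 * z
        + 8 * x * y * z ^ 2 + 8 * x ^ 2 * y * z - 8 * x * y ^ 2 * z
        + 4 * y ^ 3 * z - 4 * x * z ^ 3 - 4 * y * z ^ 3 + z ^ 4 ∧
    Septic.eisenstein 3 q =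
      x ^ 6 + 258 * x ^ 5 * y - 5904 * x ^ 4 * y ^ 2 - 5904 * x ^ 2 * y ^ 4
        - 258 * x * y ^ 5 + y ^ 6 + 258 * x ^ 5 * z + 7310 * x ^ 3 * y ^ 2 * z
        + 7310 * x ^ 2 * y ^ 3 * z + 258 * y ^ 5 * z - 5904 * x ^ 4 * z ^ 2
        + 7310 * x ^ 3 * y * z ^ 2 - 8751 * x ^ 2 * y ^ 2 * z ^ 2
        - 7310 * x * y ^ 3 * z ^ 2 - 5904 * y ^ 4 * z ^ 2 - 7310 * x ^ 2 * y * z ^ 3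
        - 7310 * x * y ^ 2 * z ^ 3 - 5904 * x ^ 2 * z ^ 4 - 5904 * y ^ 2 * z ^ 4
        - 258 * x * z ^ 5 - 258 * y * z ^ 5 + z ^ 6 ∧
    Septic.eisenstein 3 (q ^ 7) =
      x ^ 6 + 6 * x ^ 5 * y + 18 * x ^ 4 * y ^ 2 + 18 * x ^ 2 * y ^ 4
        - 6 * x * y ^ 5 + y ^ 6 + 6 * x ^ 5 * z + 2 * x ^ 3 * y ^ 2 * z
        + 2 * x ^ 2 * y ^ 3 * z + 6 * y ^ 5 * z + 18 * x ^ 4 * z ^ 2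
        + 2 * x ^ 3 * y * z ^ 2 - 57 * x ^ 2 * y ^ 2 * z ^ 2 - 2 * x * y ^ 3 * z ^ 2
        + 18 * y ^ 4 * z ^ 2 - 2 * x ^ 2 * y * z ^ 3 - 2 * x * y ^ 2 * z ^ 3
        + 18 * x ^ 2 * z ^ 4 + 18 * y ^ 2 * z ^ 4 - 6 * x * z ^ 5
        - 6 * y * z ^ 5 + z ^ 6 := by
  subst hx hy hz
  obtain ⟨hx, hy, hz⟩ := param_ne_zero τ
  obtain ⟨d12, d13, d23⟩ := weierstrassP_differences τ
  obtain ⟨v1, v2, v3⟩ := derivWeierstrassP_values τ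
  have h7 := seven_mul_im_pos τ
  have hq7 : q ^ 7 = cexp (2 * π * I * ((7 : ℕ) * τ)) := by
    rw [hq, ← Complex.exp_nat_mul]
    congr 1
    push_cast
    ring
  have n1 : 1 * (τ : ℂ) ∉ (septicPair τ).lattice := by
    have h := natCast_mul_notMem_lattice τ (j := 1) (by norm_num)
    simp only [Nat.cast_one] at h
    exact h
  have n2 : 2 * (τ : ℂ) ∉ (septicPair τ).lattice := by
    have h := natCast_mul_notMem_lattice τ (j := 2) (by norm_num)
    simp only [Nat.cast_ofNat (n := 2)] at h
    exact h
  have n3 : 3 * (τ : ℂ) ∉ (septicPair τ).lattice := by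
    have h := natCast_mul_notMem_lattice τ (j := 3) (by norm_num)
    simp only [Nat.cast_ofNat (n := 3)] at h
    exact h
  have g2 : (septicPair τ).g₂ = _ := g₂_upperPeriodPair h7 hq7
  have g3 : (septicPair τ).g₃ = _ := g₃_upperPeriodPair h7 hq7
  have g2' := g₂_upperPeriodPair τ.im_pos hq
  have g3' := g₃_upperPeriodPair τ.im_pos hq
  have V4 : (upperPeriodPair τ τ.im_pos).G 4 = (septicPair τ).G 4 + 2 * (_ + _ + _) :=
    G_upperPeriodPair_seven τ.im_pos h7 (by norm_num) (by decide)
  have V6 : (upperPeriodPair τ τ.im_pos).G 6 = (septicPair τ).G 6 + 2 * (_ + _ + _) :=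
    G_upperPeriodPair_seven τ.im_pos h7 (by norm_num) (by decide)
  change _ = _ + 2 * ((septicPair τ).sumInvPow _ _ + (septicPair τ).sumInvPow _ _ +
    (septicPair τ).sumInvPow _ _) at V4 V6
  have w1 := (septicPair τ).derivWeierstrassP_sq _ n1
  have w2 := (septicPair τ).derivWeierstrassP_sq _ n2
  have w3 := (septicPair τ).derivWeierstrassP_sq _ n3
  have hc : (2 * π * I : ℂ) ≠ 0 := by simp [Real.pi_ne_zero]
  set c : ℂ := 2 * π * I
  have m1 : ℘'[septicPair τ] (1 * τ) ≠ 0 := by rw [v1]; positivity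
  have m2 : ℘'[septicPair τ] (2 * τ) ≠ 0 := by rw [v2]; positivity
  have m3 : ℘'[septicPair τ] (3 * τ) ≠ 0 := by rw [v3]; positivity
  have s41 := (septicPair τ).sumInvPow_four n1 m1
  have s42 := (septicPair τ).sumInvPow_four n2 m2
  have s43 := (septicPair τ).sumInvPow_four n3 m3
  have s61 := (septicPair τ).sumInvPow_six n1 m1
  have s62 := (septicPair τ).sumInvPow_six n2 m2
  have s63 := (septicPair τ).sumInvPow_six n3 m3
  have hG2 : (septicPair τ).g₂ = 60 * (septicPair τ).G 4 := rfl
  have hG3 : (septicPair τ).g₃ = 140 * (septicPair τ).G 6 := rfl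
  rw [PeriodPair.g₂, V4] at g2'
  rw [PeriodPair.g₃, V6] at g3'
  rw [g2] at w1 w2 w3 s41 s42 s43 s61 s62 s63 hG2
  rw [g3] at w1 w2 w3 s61 s62 s63 hG3
  rw [v1] at w1
  rw [v2] at w2
  rw [v3] at w3
  -- Values of `℘` are scaled by `c²`, so that every relation becomes homogeneous in `c = 2πi` and
  -- `c` can be cancelled.
  have hscale (w : ℂ) : ∃ p, w = c ^ 2 * p := ⟨w / c ^ 2, by field_simp⟩
  obtain ⟨p₁, hp1⟩ := hscale (℘[septicPair τ] (1 * τ))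
  obtain ⟨p₂, hp2⟩ := hscale (℘[septicPair τ] (2 * τ))
  obtain ⟨p₃, hp3⟩ := hscale (℘[septicPair τ] (3 * τ))
  rw [hp1] at w1 s41 s61 d12 d13
  rw [hp2] at w2 s42 s62 d12 d23
  rw [hp3] at w3 s43 s63 d13 d23
  have hc2 := pow_ne_zero 2 hc
  have hc4 := pow_ne_zero 4 hc
  have hc6 := pow_ne_zero 6 hc
  refine septic_elimination (p₁ := p₁) (p₂ := p₂) (p₃ := p₃) hx hy hz
    (mul_left_cancel₀ hc2 (by linear_combination d12))
    (mul_left_cancel₀ hc2 (by linear_combination d13))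
    (mul_left_cancel₀ hc2 (by linear_combination d23))
    (mul_left_cancel₀ hc6 (by linear_combination w1))
    (mul_left_cancel₀ hc6 (by linear_combination w2))
    (mul_left_cancel₀ hc6 (by linear_combination w3))
    (mul_left_cancel₀ hc4 ?_) (mul_left_cancel₀ hc6 ?_)
  -- With primes for `ℤ + τℤ`, `g₂' = g₂ + 120 ∑ (℘² - g₂/12)`, so `-29 = 1 - 30`. Similarly `g₃' =
  -- g₃ + 280 ∑ (℘³ - 3g₂℘/20 - g₃/10)` gives `-83 = 1 - 84`.
  · linear_combination -12 * g2' - 12 * hG2 + 240 * (s41 + s42 + s43)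
  · linear_combination 216 * g3' + 216 * hG3 - 504 * (s61 + s62 + s63)
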